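/- Let $\mathbb X\subseteq\mathbb R^n$ be a Borel set, let $\mathbb U$ be a nonempty compact metric space of actions (for instance a finite set), let $\mathcal T(\cdot\mid x,u)$ be a stochastic kernel from $\mathbb X\times\mathbb U$ to $\mathbb X$, let $c:\mathbb X\times\mathbb U\to\mathbb R$ be nonnegative, bounded and continuous, and let $0<\beta<1$. Assume that $\mathcal T$ is weak Feller, i.e. $(x,u)\mapsto\int g(x_1)\,\mathcal T(dx_1\mid x,u)$ is continuous for every bounded continuous $g:\mathbb X\to\mathbb R$, and that there are constants $\alpha_c,\alpha_T>0$ such that for all $x,x'\in\mathbb X$, $u\in\mathbb U$ $$|c(x,u)-c(x',u)|\le\alpha_c\|x-x'\|_1,\qquad \|\mathcal T(\cdot\mid x,u)-\mathcal T(\cdot\mid x',u)\|_{TV}\le\alpha_T\|x-x'\|_1,$$ where $\|\mu-\nu\|_{TV}=\sup_B|\mu(B)-\nu(B)|$ over Borel sets $B$ (the result therefore also holds if $\|\cdot\|_{TV}$ is taken to be twice this quantity). An admissible policy $\gamma\in\Gamma$ is a sequence of measurable maps with $U_t=\gamma_t(X_0,\dots,X_t,U_0,\dots,U_{t-1})$;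 a stationary policy $\gamma_s\in\Gamma_s$ is given by a single measurable $f:\mathbb X\to\mathbb U$ with $U_t=f(X_t)$ for all $t$. Let $\mathbb P^\gamma_{x_0}$ be the law of $(X_t,U_t)_{t\ge0}$ with $X_0=x_0$, actions given by $\gamma$, and $X_{t+1}\sim\mathcal T(\cdot\mid X_t,U_t)$ given the past. Put $$J^*_\beta(x_0)=\inf_{\gamma\in\Gamma}\mathbb E^\gamma_{x_0}\Big[\sum_{t=0}^\infty\beta^tc(X_t,U_t)\Big],\qquad \mu_\beta^{\gamma_s}(A)=(1-\beta)\sum_{t=0}^\infty\beta^t\,\mathbb P^{\gamma_s}_{x_0}(X_t\in A).$$ Let $\{B_i\}_{i=1}^M$ be a partition of $\mathbb X$ into finitely many Borel bins with representatives $y_i\in B_i$, let $\mathbb Y=\{y_1,\dots,y_M\}$ and $q(x)=y_i$ for $x\in B_i$. Let $\pi$ be a probability measure on $\mathbb X$ with $\pi(B_i)>0$ for all $i$, and let $\hat\pi_{y_i}(A)=\pi(A\cap B_i)/\pi(B_i)$. Put $$C^*(y_i,u)=\int_{B_i}c(x,u)\,\hat\pi_{y_i}(dx),\quad P^*(y_j\mid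 y_i,u)=\int_{B_i}\mathcal T(B_j\mid x,u)\,\hat\pi_{y_i}(dx),\quad L(x)=\int_{B_i}\|x-x'\|_1\,\hat\pi_{y_i}(dx')\in[0,\infty]\ \ (x\in B_i).$$ Then the dynamic programming equation $$\hat J_\beta(y)=\inf_{u\in\mathbb U}\Big\{C^*(y,u)+\beta\sum_{z\in\mathbb Y}\hat J_\beta(z)P^*(z\mid y,u)\Big\},\qquad y\in\mathbb Y,$$ has a unique solution $\hat J_\beta:\mathbb Y\to\mathbb R$, and, with $\hat J_\beta(x):=\hat J_\beta(q(x))$, for every $x_0\in\mathbb X$ $$\big|\hat J_\beta(x_0)-J^*_\beta(x_0)\big|\le\Big(\alpha_c+\frac{\beta\alpha_T\|c\|_\infty}{1-\beta}\Big)\frac1{1-\beta}\,\sup_{\gamma_s\in\Gamma_s}\int_{\mathbb X}L(x)\,\mu_\beta^{\gamma_s}(dx),$$ where $\|c\|_\infty=\sup|c|$ and the right-hand side may be $+\infty$. -/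

import Mathlib

open MeasureTheory ProbabilityTheory
open scoped ENNReal BoundedContinuousFunction

namespace QuantizedMDP

noncomputable section

section Dynamics

variable {X U : Type*} [MeasurableSpace X] [MeasurableSpace U]

/-- A (deterministic, history dependent) admissible policy: `U₀ = init X₀`, and
`U_{t+1} = step t (((X₀, U₀), …, (X_t, U_t)), X_{t+1})`, all maps being measurable. -/
structure AdmissiblePolicy (X U : Type*) [MeasurableSpace X] [MeasurableSpace U] where
  init : X → U
  measurable_init : Measurable init
  step : ∀ t : ℕ, ((Finset.Iic t → X × U) × X) → U
  measurable_step : ∀ t, Measurable (step t)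

/-- A stationary policy: one measurable map from states to actions, used at all times. -/
abbrev StationaryPolicy (X U : Type*) [MeasurableSpace X] [MeasurableSpace U] :=
  {f : X → U // Measurable f}

/-- A stationary policy, seen as an admissible one: `U_t = f X_t` for all `t`. -/
def StationaryPolicy.toAdmissible (f : StationaryPolicy X U) : AdmissiblePolicy X U where
  init := f.1
  measurable_init := f.2
  step := fun _ h => f.1 h.2
  measurable_step := fun _ => f.2.comp measurable_snd

/-- Law of `(X_{t+1}, U_{t+1})` given `((X₀, U₀), …, (X_t, U_t))`: the next state is drawn from
`T (X_t, U_t)` and the next action is then given by the policy. -/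
def transition (T : Kernel (X × U) X) (γ : AdmissiblePolicy X U) (t : ℕ) :
    Kernel (Finset.Iic t → X × U) (X × U) :=
  (Kernel.id ×ₖ T.comap
    (fun h : Finset.Iic t → X × U => h ⟨t, Finset.mem_Iic.2 le_rfl⟩)
    (measurable_pi_apply _)).map (fun p => (p.2, γ.step t p))

instance (T : Kernel (X × U) X) [IsMarkovKernel T] (γ : AdmissiblePolicy X U) (t : ℕ) :
    IsMarkovKernel (transition T γ t) :=
  Kernel.IsMarkovKernel.map _ (measurable_snd.prodMk (γ.measurable_step t))

/-- The law on state-action trajectories `ω`, with `ω t = (X_t, U_t)`, of the process started at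
`x₀` and controlled by `γ`. -/
def strategicMeasure (T : Kernel (X × U) X) [IsMarkovKernel T] (γ : AdmissiblePolicy X U)
    (x₀ : X) : Measure (ℕ → X × U) :=
  Kernel.trajMeasure (X := fun _ => X × U) (Measure.dirac (x₀, γ.init x₀)) (transition T γ)

/-- The discounted cost of the policy `γ` started at `x₀`. -/
def discountedCost (T : Kernel (X × U) X) [IsMarkovKernel T] (c : X × U → ℝ) (β : ℝ)
    (γ : AdmissiblePolicy X U) (x₀ : X) : ℝ :=
  ∫ ω, ∑' t : ℕ, β ^ t * c (ω t) ∂(strategicMeasure T γ x₀)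

/-- The optimal discounted cost: the infimum over all admissible policies. -/
def optimalCost (T : Kernel (X × U) X) [IsMarkovKernel T] (c : X × U → ℝ) (β : ℝ)
    (x₀ : X) : ℝ :=
  ⨅ γ : AdmissiblePolicy X U, discountedCost T c β γ x₀

/-- The law of `X_t` under the stationary policy `f`, started at `x₀`. -/
def stateLaw (T : Kernel (X × U) X) [IsMarkovKernel T] (f : StationaryPolicy X U) (x₀ : X)
    (t : ℕ) : Measure X :=
  (strategicMeasure T f.toAdmissible x₀).map (fun ω => (ω t).1)

/-- The normalized discounted state occupation measure `(1 - β) ∑ₜ βᵗ Law(X_t)`. -/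
def occupationMeasure (T : Kernel (X × U) X) [IsMarkovKernel T] (β : ℝ)
    (f : StationaryPolicy X U) (x₀ : X) : Measure X :=
  ENNReal.ofReal (1 - β) •
    Measure.sum (fun t : ℕ => ENNReal.ofReal (β ^ t) • stateLaw T f x₀ t)

/-- The total variation distance `sup_B |μ B - ν B|`, over measurable sets `B`. -/
def tvDist (μ ν : Measure X) : ℝ :=
  ⨆ B : {B : Set X // MeasurableSet B}, |μ.real B - ν.real B|

end Dynamics

section FiniteModel

/-- A quantizer: a partition of `X` into finitely many measurable bins, each with a representative
state inside it. Bins are indexed by their representatives. -/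
structure Quantizer (X : Type*) [MeasurableSpace X] where
  reps : Finset X
  bin : reps → Set X
  measurableSet_bin : ∀ y, MeasurableSet (bin y)
  disjoint_bin : ∀ y z, y ≠ z → Disjoint (bin y) (bin z)
  iUnion_bin : ⋃ y, bin y = Set.univ
  rep_mem_bin : ∀ y, (y : X) ∈ bin y

variable {X U : Type*} [MeasurableSpace X] [MeasurableSpace U]

/-- The quantizer map: `q x` is the representative of the bin that contains `x`. -/
def Quantizer.q (Q : Quantizer X) (x : X) : Q.reps :=
  Classical.choose (Set.mem_iUnion.1 (Q.iUnion_bin.symm ▸ Set.mem_univ x : x ∈ ⋃ y, Q.bin y))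

/-- The normalized weighting measure `π(· ∩ B_y) / π(B_y)` on the bin of `y`. -/
def Quantizer.binMeasure (Q : Quantizer X) (π : Measure X) (y : Q.reps) : Measure X :=
  ProbabilityTheory.cond π (Q.bin y)

/-- Stage cost of the finite model. -/
def Quantizer.cost (Q : Quantizer X) (π : Measure X) (c : X × U → ℝ) (y : Q.reps) (u : U) : ℝ :=
  ∫ x in Q.bin y, c (x, u) ∂(Q.binMeasure π y)

/-- Transition probability from `y` to `z` under the action `u` in the finite model. -/
def Quantizer.prob (Q : Quantizer X) (π : Measure X) (T : Kernel (X × U) X)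
    (z y : Q.reps) (u : U) : ℝ :=
  ∫ x in Q.bin y, (T (x, u)).real (Q.bin z) ∂(Q.binMeasure π y)

/-- `J` solves the discounted dynamic programming equation of the finite model. -/
def Quantizer.IsFiniteValue (Q : Quantizer X) (π : Measure X) (T : Kernel (X × U) X)
    (c : X × U → ℝ) (β : ℝ) (J : Q.reps → ℝ) : Prop :=
  ∀ y, J y = ⨅ u : U, (Q.cost π c y u + β * ∑ z, J z * Q.prob π T z y u)

/-- `ℝⁿ` with the norm `‖x‖₁ = ∑ |xᵢ|`. -/
abbrev L1Space (n : ℕ) := PiLp 1 (fun _ : Fin n => ℝ)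

/-- The loss `L x = ∫ ‖x - x'‖₁ π̂(dx')` over the bin that contains `x`. It takes values in
`[0, ∞]`, since `π` need not have a first moment. -/
def Quantizer.loss {n : ℕ} {S : Set (L1Space n)} (Q : Quantizer S) (π : Measure S) (x : S) :
    ℝ≥0∞ :=
  ∫⁻ x' in Q.bin (Q.q x), ‖(x : L1Space n) - (x' : L1Space n)‖ₑ ∂(Q.binMeasure π (Q.q x))

end FiniteModel

end

end QuantizedMDP

open QuantizedMDP

open QuantizedMDP

namespace QuantizedMDP

/-! ### The trajectory law: initial state, Markov property, prescribed actions. -/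

section Trajectories

variable {X U : Type*} [MeasurableSpace X] [MeasurableSpace U]

/-! Write `J` for the value of the finite model and `D(x, u)` for the gap between its state-action
value at `(q x, u)` and `c(x, u) + β ∫ J(q y) T(dy | x, u)`. The gap is an average over the bin of
`x` of differences of costs and of transition integrals. Since `0 ≤ J ≤ ‖c‖ / (1 - β)`, the
Lipschitz hypotheses give `|D(x, u)| ≤ (αc + β αT ‖c‖ / (1 - β)) L(x)`
(`Quantizer.ofReal_abs_modelError_le`).

The rest is a comparison principle: a bounded `v` with `v ≤ h + ε + β T v` along a controlled
trajectory is at most the discounted cost of `h`, plus `ε / (1 - β)` (`sub_le_discountedCost`). Let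
`v` be a bounded continuous Bellman solution; the principle gives `v ≤ J*`. Under an `ε`-optimal
selector for `v`, the function `J ∘ q - v` satisfies the inequality with `h = |D|`, which bounds `J
∘ q - J*` above. Under an `ε`-optimal policy of the finite model, `-J ∘ q` satisfies it with `h =
|D| - c`, which bounds `J* - J ∘ q`.

Both comparison policies are stationary, so the discounted cost of `|D|` is an integral against an
occupation measure (`ofReal_discountedCost_le`); this is why the supremum runs over stationary
policies only. -/

theorem integrable_of_abs_le {Ω : Type*} [MeasurableSpace Ω] {μ : Measure Ω} [IsFiniteMeasure μ]
    {g : Ω → ℝ} {C : ℝ} (hg : Measurable g) (hC : ∀ x, |g x| ≤ C) : Integrable g μ :=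
  Integrable.of_bound hg.aestronglyMeasurable C (Filter.Eventually.of_forall hC)

theorem abs_integral_le_of_abs_le {Ω : Type*} [MeasurableSpace Ω] {μ : Measure Ω}
    [IsProbabilityMeasure μ] {g : Ω → ℝ} {C : ℝ} (hC : ∀ x, |g x| ≤ C) : |∫ x, g x ∂μ| ≤ C := by
  have h : ∀ᵐ x ∂μ, ‖g x‖ ≤ C := Filter.Eventually.of_forall hC
  simpa using norm_integral_le_of_norm_le_const h

variable (T : Kernel (X × U) X) [IsMarkovKernel T] (γ : AdmissiblePolicy X U) (x₀ : X)

instance : IsProbabilityMeasure (strategicMeasure T γ x₀) := by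
  unfold strategicMeasure; infer_instance

/-- The trajectory starts at `(x₀, γ.init x₀)`. -/
theorem strategicMeasure_map_zero :
    (strategicMeasure T γ x₀).map (fun ω => ω 0) = Measure.dirac (x₀, γ.init x₀) := by
  have h : (fun ω : ℕ → X × U => ω 0) =
      (fun h : Finset.Iic 0 → X × U => h ⟨0, Finset.mem_Iic.2 le_rfl⟩) ∘
        Preorder.frestrictLe (π := fun _ => X × U) 0 := rfl
  rw [h, ← Measure.map_map (by fun_prop) (by fun_prop), strategicMeasure, Kernel.trajMeasure,
    Measure.map_comp _ _ (by fun_prop), Kernel.traj_map_frestrictLe, Kernel.partialTraj_self,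
    Measure.id_comp, Measure.map_map (by fun_prop) (by fun_prop)]
  exact Measure.map_id

/-- Disintegration of the law of the history up to time `t + 1`. -/
theorem strategicMeasure_map_compProd (t : ℕ) :
    (strategicMeasure T γ x₀).map
      (fun ω => (Preorder.frestrictLe (π := fun _ => X × U) t ω, ω (t + 1))) =
      (strategicMeasure T γ x₀).map (Preorder.frestrictLe (π := fun _ => X × U) t)
        ⊗ₘ transition T γ t :=
  Kernel.map_frestrictLe_trajMeasure_compProd_eq_map_trajMeasure.symm

theorem transition_apply (t : ℕ) (h : Finset.Iic t → X × U) :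
    transition T γ t h = (T (h ⟨t, Finset.mem_Iic.2 le_rfl⟩)).map (fun x => (x, γ.step t (h, x)))
      := by
  have hm := γ.measurable_step t
  rw [transition, Kernel.map_apply _ (measurable_snd.prodMk hm), Kernel.prod_apply,
    Kernel.id_apply, Kernel.comap_apply,
    Measure.dirac_prod, Measure.map_map (measurable_snd.prodMk hm) (by fun_prop)]
  rfl

/-- The Markov property: given the past, `X_{t+1}` has law `T (X_t, U_t)`. -/
theorem integral_state_succ (t : ℕ) {g : X → ℝ} (hg : Measurable g) {C : ℝ}
    (hC : ∀ x, |g x| ≤ C) :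
    ∫ ω, g (ω (t + 1)).1 ∂strategicMeasure T γ x₀ =
      ∫ ω, ∫ y, g y ∂T (ω t) ∂strategicMeasure T γ x₀ := by
  have hg' : Measurable fun p : (Finset.Iic t → X × U) × (X × U) => g p.2.1 := by fun_prop
  have h1 : ∫ ω, g (ω (t + 1)).1 ∂strategicMeasure T γ x₀ =
      ∫ p, g p.2.1 ∂(strategicMeasure T γ x₀).map
        (fun ω => (Preorder.frestrictLe (π := fun _ => X × U) t ω, ω (t + 1))) := by
    rw [integral_map (by fun_prop) hg'.aestronglyMeasurable]
  have hm : Measurable fun h : Finset.Iic t → X × U => ∫ y, g y ∂T (h ⟨t, Finset.mem_Iic.2 le_rfl⟩)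
    :=
    (StronglyMeasurable.integral_kernel (κ := T) hg.stronglyMeasurable).measurable.comp
      (measurable_pi_apply _)
  have : IsProbabilityMeasure ((strategicMeasure T γ x₀).map
      (Preorder.frestrictLe (π := fun _ => X × U) t)) :=
    Measure.isProbabilityMeasure_map (by fun_prop)
  rw [h1, strategicMeasure_map_compProd,
    Measure.integral_compProd (integrable_of_abs_le hg' fun p => hC p.2.1)]
  have h2 : ∀ h : Finset.Iic t → X × U, ∫ z, g z.1 ∂transition T γ t h =
      ∫ y, g y ∂T (h ⟨t, Finset.mem_Iic.2 le_rfl⟩) := fun h => by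
    have hs := γ.measurable_step t
    have hg₁ : Measurable fun z : X × U => g z.1 := by fun_prop
    rw [transition_apply, integral_map (by fun_prop) hg₁.aestronglyMeasurable]
  simp_rw [h2]
  rw [integral_map (by fun_prop) hm.aestronglyMeasurable]
  rfl

/-- Under a stationary policy, the actions are almost surely the prescribed ones. -/
theorem ae_action_eq [MeasurableEq U] (f : StationaryPolicy X U) (t : ℕ) :
    ∀ᵐ ω ∂strategicMeasure T f.toAdmissible x₀, (ω t).2 = f.1 (ω t).1 := by
  have hS : MeasurableSet {p : X × U | p.2 = f.1 p.1} :=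
    measurableSet_eq_fun measurable_snd (f.2.comp measurable_fst)
  cases t with
  | zero =>
    rw [← ae_map_iff (f := fun ω : ℕ → X × U => ω 0) (measurable_pi_apply 0).aemeasurable hS,
      strategicMeasure_map_zero,
      ae_dirac_iff hS]
    rfl
  | succ t =>
    have hS' : MeasurableSet {p : (Finset.Iic t → X × U) × (X × U) | p.2.2 = f.1 p.2.1} :=
      measurable_snd hS
    rw [← ae_map_iff (f := fun ω : ℕ → X × U =>
      (Preorder.frestrictLe (π := fun _ => X × U) t ω, ω (t + 1))) (by fun_prop) hS',
      strategicMeasure_map_compProd, Measure.ae_compProd_iff hS']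
    refine Filter.Eventually.of_forall fun h => ?_
    have hs : Measurable fun x => (x, f.toAdmissible.step t (h, x)) := measurable_id.prodMk f.2
    rw [transition_apply, ae_map_iff hs.aemeasurable hS]
    exact Filter.Eventually.of_forall fun _ => rfl

end Trajectories

/-! ### Discounted costs and the comparison principle. -/

section DiscountedCost

variable {X U : Type*} [MeasurableSpace X] [MeasurableSpace U]
  (T : Kernel (X × U) X) [IsMarkovKernel T] (γ : AdmissiblePolicy X U) (x₀ : X)
  {β : ℝ}

/-- The discounted cost is the discounted sum of the expected stage costs. -/
theorem hasSum_discountedCost (hβ₀ : 0 < β) (hβ₁ : β < 1) {h : X × U → ℝ} (hh : Measurable h)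
    {C : ℝ}
    (hC : ∀ p, |h p| ≤ C) :
    HasSum (fun t : ℕ => β ^ t * ∫ ω, h (ω t) ∂strategicMeasure T γ x₀)
      (discountedCost T h β γ x₀) := by
  have hm : ∀ t : ℕ, Measurable fun ω : ℕ → X × U => h (ω t) := fun t => by fun_prop
  have := hasSum_integral_of_summable_integral_norm (μ := strategicMeasure T γ x₀)
    (F := fun (t : ℕ) ω => β ^ t * h (ω t))
    (fun t => (integrable_of_abs_le (hm t) fun ω => hC _).const_mul _) ?_
  · simp only [integral_const_mul] at this
    exact this
  -- The geometric bound `β ^ t * C` justifies exchanging sum and expectation.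
  · refine Summable.of_nonneg_of_le (fun t => by positivity) (fun t => ?_)
      ((summable_geometric_of_lt_one hβ₀.le hβ₁).mul_right C)
    simp only [norm_mul, norm_pow, Real.norm_eq_abs, integral_const_mul, abs_of_pos hβ₀]
    gcongr
    exact (le_abs_self _).trans (abs_integral_le_of_abs_le fun ω => by simpa using hC (ω t))

theorem discountedCost_sub (hβ₀ : 0 < β) (hβ₁ : β < 1) {h k : X × U → ℝ} (hh : Measurable h)
    {C : ℝ} (hC : ∀ p, |h p| ≤ C)
    (hk : Measurable k) {D : ℝ} (hD : ∀ p, |k p| ≤ D) :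
    discountedCost T (fun p => h p - k p) β γ x₀ =
      discountedCost T h β γ x₀ - discountedCost T k β γ x₀ := by
  have h1 := (hasSum_discountedCost T γ x₀ hβ₀ hβ₁ hh hC).sub
    (hasSum_discountedCost T γ x₀ hβ₀ hβ₁ hk hD)
  have h2 := hasSum_discountedCost T γ x₀ hβ₀ hβ₁ (hh.sub hk) (C := C + D)
    fun p => (abs_sub _ _).trans (add_le_add (hC p) (hD p))
  have h3 : ∀ t : ℕ, β ^ t * ∫ ω, h (ω t) ∂strategicMeasure T γ x₀ -
      β ^ t * ∫ ω, k (ω t) ∂strategicMeasure T γ x₀ =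
      β ^ t * ∫ ω, (h - k) (ω t) ∂strategicMeasure T γ x₀ := fun t => by
    rw [← mul_sub, ← integral_sub]
    · rfl
    · exact integrable_of_abs_le (hh.comp (measurable_pi_apply t)) fun ω => hC _
    · exact integrable_of_abs_le (hk.comp (measurable_pi_apply t)) fun ω => hD _
  simp only [h3] at h1
  exact h2.unique h1

/-- A function that satisfies the Bellman inequality up to `ε` along the trajectories is, up to
`ε / (1 - β)`, at most the discounted cost. -/
theorem sub_le_discountedCost (hβ₀ : 0 < β) (hβ₁ : β < 1) {v : X → ℝ} (hv : Measurable v) {C : ℝ}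
    (hvC : ∀ x, |v x| ≤ C)
    {h : X × U → ℝ} (hh : Measurable h) {D : ℝ} (hD : ∀ p, |h p| ≤ D) {ε : ℝ}
    (hle : ∀ t : ℕ, ∀ᵐ ω ∂strategicMeasure T γ x₀,
      v (ω t).1 ≤ h (ω t) + ε + β * ∫ y, v y ∂T (ω t)) :
    v x₀ - ε / (1 - β) ≤ discountedCost T h β γ x₀ := by
  set μ := strategicMeasure T γ x₀ with hμ
  have hTm : Measurable fun p : X × U => ∫ y, v y ∂T p :=
    (StronglyMeasurable.integral_kernel (κ := T) hv.stronglyMeasurable).measurable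
  have hstep : ∀ t : ℕ, ∫ ω, v (ω t).1 ∂μ ≤
      ∫ ω, h (ω t) ∂μ + ε + β * ∫ ω, v (ω (t + 1)).1 ∂μ := fun t => by
    have i1 : Integrable (fun ω : ℕ → X × U => h (ω t)) μ :=
      integrable_of_abs_le (by fun_prop) fun ω => hD _
    have i2 : Integrable (fun ω : ℕ → X × U => ∫ y, v y ∂T (ω t)) μ :=
      integrable_of_abs_le (hTm.comp (measurable_pi_apply t))
        fun ω => abs_integral_le_of_abs_le hvC
    have i3 : Integrable (fun ω : ℕ → X × U => v (ω t).1) μ :=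
      integrable_of_abs_le (by fun_prop) fun ω => hvC _
    have i4 : Integrable (fun _ : ℕ → X × U => ε) μ := integrable_const _
    calc ∫ ω, v (ω t).1 ∂μ ≤ ∫ ω, (h (ω t) + ε + β * ∫ y, v y ∂T (ω t)) ∂μ :=
          integral_mono_ae i3 ((i1.add i4).add (i2.const_mul β)) (hle t)
      _ = _ := by
          have i5 : Integrable (fun ω : ℕ → X × U => h (ω t) + ε) μ := i1.add i4
          rw [integral_add i5 (i2.const_mul β), integral_add i1 i4, integral_const_mul,
            integral_state_succ T γ x₀ t hv hvC, ← hμ]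
          simp
  have hpart : ∀ n : ℕ, v x₀ ≤ ∑ t ∈ Finset.range n, β ^ t * ∫ ω, h (ω t) ∂μ +
      (∑ t ∈ Finset.range n, β ^ t) * ε + β ^ n * C := fun n => by
    -- Iterating the one-step inequality keeps the exact remainder `β ^ n * E[v(X_n)]`; it is
    -- replaced by `β ^ n * C`, which tends to `0`, only after the induction.
    have key : v x₀ ≤ ∑ t ∈ Finset.range n, β ^ t * ∫ ω, h (ω t) ∂μ +
        (∑ t ∈ Finset.range n, β ^ t) * ε + β ^ n * ∫ ω, v (ω n).1 ∂μ := by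
      induction n with
      | zero =>
        have : ∫ ω, v (ω 0).1 ∂μ = v x₀ := by
          have hv₁ : Measurable fun p : X × U => v p.1 := by fun_prop
          have h0 := integral_map (μ := μ) (φ := fun ω : ℕ → X × U => ω 0)
            (f := fun p : X × U => v p.1)
            (measurable_pi_apply 0).aemeasurable hv₁.aestronglyMeasurable
          rw [hμ, strategicMeasure_map_zero,
            integral_dirac' _ _ hv₁.stronglyMeasurable] at h0
          exact h0.symm
        simp [this]
      | succ n ih =>
        have := mul_le_mul_of_nonneg_left (hstep n) (pow_nonneg hβ₀.le n)
        rw [Finset.sum_range_succ, Finset.sum_range_succ, pow_succ]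
        linarith
    refine key.trans ?_
    gcongr
    exact (le_abs_self _).trans (abs_integral_le_of_abs_le fun ω => hvC _)
  have hlim := (((hasSum_discountedCost T γ x₀ hβ₀ hβ₁ hh hD).tendsto_sum_nat.add
    ((hasSum_geometric_of_lt_one hβ₀.le hβ₁).tendsto_sum_nat.mul_const ε)).add
    ((tendsto_pow_atTop_nhds_zero_of_lt_one hβ₀.le hβ₁).mul_const C))
  have := ge_of_tendsto' hlim hpart
  rw [div_eq_inv_mul]
  linarith

/-- The discounted cost of a nonnegative stage cost under a stationary policy, in terms of the
occupation measure. -/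
theorem ofReal_discountedCost_le (hβ₀ : 0 < β) (hβ₁ : β < 1) [MeasurableEq U]
    (f : StationaryPolicy X U) {h : X × U → ℝ}
    (hh : Measurable h) (h0 : ∀ p, 0 ≤ h p) {C : ℝ} (hC : ∀ p, h p ≤ C) {L : X → ℝ≥0∞} {K : ℝ≥0∞}
    (hK : K ≠ ∞) (hL : ∀ p, ENNReal.ofReal (h p) ≤ K * L p.1) :
    ENNReal.ofReal (discountedCost T h β f.toAdmissible x₀) ≤
      K * ENNReal.ofReal (1 / (1 - β)) * ∫⁻ x, L x ∂occupationMeasure T β f x₀ := by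
  have hC' : ∀ p, |h p| ≤ C := fun p => by rw [abs_of_nonneg (h0 p)]; exact hC p
  have hsum := hasSum_discountedCost T f.toAdmissible x₀ hβ₀ hβ₁ hh hC'
  have hnn : ∀ t : ℕ, 0 ≤ ∫ ω, h (ω t) ∂strategicMeasure T f.toAdmissible x₀ := fun t =>
    integral_nonneg fun ω => h0 _
  have hstage : ∀ t : ℕ, ENNReal.ofReal (∫ ω, h (ω t) ∂strategicMeasure T f.toAdmissible x₀) ≤
      K * ∫⁻ x, L x ∂stateLaw T f x₀ t := fun t => by
    rw [ofReal_integral_eq_lintegral_ofReal (integrable_of_abs_le (by fun_prop) fun ω => hC' _)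
      (Filter.Eventually.of_forall fun ω => h0 _)]
    have hm : Measurable fun x => ENNReal.ofReal (h (x, f.1 x)) :=
      (hh.comp (measurable_id.prodMk f.2)).ennreal_ofReal
    calc ∫⁻ ω, ENNReal.ofReal (h (ω t)) ∂strategicMeasure T f.toAdmissible x₀
        = ∫⁻ ω, ENNReal.ofReal (h ((ω t).1, f.1 (ω t).1))
            ∂strategicMeasure T f.toAdmissible x₀ := by
          refine lintegral_congr_ae ?_
          filter_upwards [ae_action_eq T x₀ f t] with ω hω
          rw [← hω]
      _ = ∫⁻ x, ENNReal.ofReal (h (x, f.1 x)) ∂stateLaw T f x₀ t := by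
          rw [stateLaw, lintegral_map hm (by fun_prop)]
      _ ≤ ∫⁻ x, K * L x ∂stateLaw T f x₀ t := lintegral_mono fun x => hL (x, f.1 x)
      -- Finiteness of `K` allows it to be pulled out without measurability of `L`.
      _ = _ := lintegral_const_mul' _ _ hK
  rw [← hsum.tsum_eq, ENNReal.ofReal_tsum_of_nonneg (fun t => mul_nonneg (by positivity) (hnn t))
    hsum.summable, occupationMeasure, lintegral_smul_measure, lintegral_sum_measure]
  simp only [lintegral_smul_measure, smul_eq_mul]
  -- The factor `1 / (1 - β)` cancels the normalization of the occupation measure.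
  rw [← mul_assoc, mul_assoc K, ← ENNReal.ofReal_mul (by rw [one_div_nonneg]; linarith),
    one_div_mul_cancel (by linarith), ENNReal.ofReal_one, mul_one, ← ENNReal.tsum_mul_left]
  refine ENNReal.tsum_le_tsum fun t => ?_
  rw [ENNReal.ofReal_mul (by positivity), mul_left_comm]
  gcongr
  exact hstage t

end DiscountedCost

/-- Infima are nonexpansive in the sup norm; this makes both dynamic programming operators
`β`-contractions. -/
theorem abs_ciInf_sub_ciInf_le {ι : Type*} [Nonempty ι] {f g : ι → ℝ} {C : ℝ}
    (hf : BddBelow (Set.range f)) (hg : BddBelow (Set.range g)) (h : ∀ i, |f i - g i| ≤ C) :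
    |(⨅ i, f i) - ⨅ i, g i| ≤ C := by
  have h1 : (⨅ i, f i) - C ≤ ⨅ i, g i := le_ciInf fun i => by
    linarith [ciInf_le hf i, (abs_le.1 (h i)).2]
  have h2 : (⨅ i, g i) - C ≤ ⨅ i, f i := le_ciInf fun i => by
    linarith [ciInf_le hg i, (abs_le.1 (h i)).1]
  rw [abs_le]
  constructor <;> linarith

/-! ### Total variation distance. -/

section TotalVariation

variable {X : Type*} [MeasurableSpace X]

theorem abs_real_sub_real_le_tvDist (μ ν : Measure X) [IsProbabilityMeasure μ]
    [IsProbabilityMeasure ν] {B : Set X} (hB : MeasurableSet B) :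
    |μ.real B - ν.real B| ≤ tvDist μ ν := by
  refine le_ciSup (f := fun B : {B : Set X // MeasurableSet B} => |μ.real B - ν.real B|) ?_ ⟨B, hB⟩
  refine ⟨1, ?_⟩
  rintro _ ⟨A, rfl⟩
  have h1 : μ.real A ≤ 1 := measureReal_le_one
  have h2 : ν.real A ≤ 1 := measureReal_le_one
  have h3 : 0 ≤ μ.real A := measureReal_nonneg
  have h4 : 0 ≤ ν.real A := measureReal_nonneg
  rw [abs_le]
  constructor <;> linarith

theorem tvDist_comm (μ ν : Measure X) : tvDist μ ν = tvDist ν μ := by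
  simp only [tvDist, abs_sub_comm]

end TotalVariation

/-! ### Bins, step functions and the finite model. -/

namespace Quantizer

variable {X U : Type*} [MeasurableSpace X] [MeasurableSpace U] (Q : Quantizer X)

theorem mem_bin_q (x : X) : x ∈ Q.bin (Q.q x) :=
  Classical.choose_spec
    (Set.mem_iUnion.1 (Q.iUnion_bin.symm ▸ Set.mem_univ x : x ∈ ⋃ y, Q.bin y))

theorem mem_bin_iff {x : X} {y : Q.reps} : x ∈ Q.bin y ↔ Q.q x = y := by
  refine ⟨fun h => ?_, fun h => h ▸ Q.mem_bin_q x⟩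
  by_contra hne
  exact Set.disjoint_left.1 (Q.disjoint_bin _ _ hne) (Q.mem_bin_q x) h

theorem measurable_q [MeasurableSingletonClass X] : Measurable Q.q :=
  measurable_to_countable' fun y => by
    convert Q.measurableSet_bin y using 1
    ext x
    simp [Q.mem_bin_iff]

/-- A function on the representatives, evaluated at the quantized state, is a step function. -/
theorem integral_comp_q (ν : Measure X) [IsProbabilityMeasure ν] (J : Q.reps → ℝ) :
    ∫ x, J (Q.q x) ∂ν = ∑ z, J z * ν.real (Q.bin z) := by
  have h : ∀ x, J (Q.q x) = ∑ z, (Q.bin z).indicator (fun _ => J z) x := fun x => by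
    rw [Finset.sum_eq_single (Q.q x)]
    · rw [Set.indicator_of_mem (Q.mem_bin_q x)]
    · intro z _ hz
      exact Set.indicator_of_notMem (fun hx => hz (Q.mem_bin_iff.1 hx).symm) _
    · simp
  simp_rw [h]
  rw [integral_finsetSum _ fun z _ => (integrable_const _).indicator (Q.measurableSet_bin z)]
  refine Finset.sum_congr rfl fun z _ => ?_
  rw [integral_indicator_const _ (Q.measurableSet_bin z), smul_eq_mul, mul_comm]

theorem sum_real_bin (ν : Measure X) [IsProbabilityMeasure ν] :
    ∑ z, ν.real (Q.bin z) = 1 := by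
  simpa using (Q.integral_comp_q ν fun _ => 1).symm

/-- Bins of negative difference contribute at most `0`, and on the others `J` is at most `M`. The
latter bins form one measurable set, so a single set difference bounds the sum. Using `0 ≤ J ≤ M`
rather than `|J| ≤ M` avoids a factor `2`. -/
theorem sum_mul_sub_le (μ ν : Measure X) [IsProbabilityMeasure μ] [IsProbabilityMeasure ν]
    {J : Q.reps → ℝ} {M : ℝ} (h0 : ∀ z, 0 ≤ J z) (hM0 : 0 ≤ M) (hM : ∀ z, J z ≤ M) :
    ∑ z, J z * (μ.real (Q.bin z) - ν.real (Q.bin z)) ≤ M * tvDist μ ν := by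
  classical
  set P := Finset.univ.filter fun z => 0 ≤ μ.real (Q.bin z) - ν.real (Q.bin z) with hP
  have hU : ∀ (ρ : Measure X) [IsProbabilityMeasure ρ],
      ρ.real (⋃ z ∈ P, Q.bin z) = ∑ z ∈ P, ρ.real (Q.bin z) := fun ρ _ =>
    measureReal_biUnion_finset (fun y _ z _ hyz => Q.disjoint_bin y z hyz)
      fun z _ => Q.measurableSet_bin z
  calc ∑ z, J z * (μ.real (Q.bin z) - ν.real (Q.bin z))
      ≤ ∑ z, if 0 ≤ μ.real (Q.bin z) - ν.real (Q.bin z) then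
          M * (μ.real (Q.bin z) - ν.real (Q.bin z)) else 0 := by
        refine Finset.sum_le_sum fun z _ => ?_
        split_ifs with h
        · exact mul_le_mul_of_nonneg_right (hM z) h
        · exact mul_nonpos_of_nonneg_of_nonpos (h0 z) (not_le.1 h).le
    _ = M * (μ.real (⋃ z ∈ P, Q.bin z) - ν.real (⋃ z ∈ P, Q.bin z)) := by
        rw [← Finset.sum_filter, ← Finset.mul_sum, Finset.sum_sub_distrib, hU, hU]
    _ ≤ M * tvDist μ ν := by
        gcongr
        exact (le_abs_self _).trans (abs_real_sub_real_le_tvDist μ ν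
          (P.measurableSet_biUnion fun z _ => Q.measurableSet_bin z))

theorem abs_sum_mul_sub_le (μ ν : Measure X) [IsProbabilityMeasure μ] [IsProbabilityMeasure ν]
    {J : Q.reps → ℝ} {M : ℝ} (h0 : ∀ z, 0 ≤ J z) (hM0 : 0 ≤ M) (hM : ∀ z, J z ≤ M) :
    |∑ z, J z * (μ.real (Q.bin z) - ν.real (Q.bin z))| ≤ M * tvDist μ ν := by
  refine abs_le'.2 ⟨Q.sum_mul_sub_le μ ν h0 hM0 hM, ?_⟩
  rw [tvDist_comm, ← Finset.sum_neg_distrib]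
  refine le_of_eq_of_le (Finset.sum_congr rfl fun z _ => ?_) (Q.sum_mul_sub_le ν μ h0 hM0 hM)
  ring

variable {π : Measure X}

theorem isProbabilityMeasure_restrict_bin [IsProbabilityMeasure π] (hπ : ∀ y, 0 < π (Q.bin y))
    (y : Q.reps) :
    IsProbabilityMeasure ((Q.binMeasure π y).restrict (Q.bin y)) := by
  constructor
  rw [Measure.restrict_apply_univ, binMeasure]
  exact cond_apply_self (hπ y).ne' (measure_ne_top _ _)

/-! ### Value function and model error of the finite model. -/

section Model

variable (T : Kernel (X × U) X) {c : X × U → ℝ} {C β : ℝ}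

theorem measurable_real_bin (z : Q.reps) : Measurable fun p => (T p).real (Q.bin z) :=
  (T.measurable_coe (Q.measurableSet_bin z)).ennreal_toReal

theorem integrable_real_bin [IsMarkovKernel T] (ν : Measure X) [IsProbabilityMeasure ν]
    (z : Q.reps) (u : U) :
    Integrable (fun x => (T (x, u)).real (Q.bin z)) ν :=
  integrable_of_abs_le (C := 1) ((Q.measurable_real_bin T z).comp (by fun_prop)) fun x => by
    rw [abs_of_nonneg measureReal_nonneg]
    exact measureReal_le_one

theorem prob_nonneg (z y : Q.reps) (u : U) : 0 ≤ Q.prob π T z y u :=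
  integral_nonneg fun _ => measureReal_nonneg

theorem sum_prob [IsProbabilityMeasure π] [IsMarkovKernel T] (hπ : ∀ y, 0 < π (Q.bin y))
    (y : Q.reps) (u : U) :
    ∑ z, Q.prob π T z y u = 1 := by
  have := Q.isProbabilityMeasure_restrict_bin hπ y
  simp only [prob]
  rw [← integral_finsetSum _ fun z _ => Q.integrable_real_bin T _ z u]
  simp_rw [Q.sum_real_bin]
  simp

theorem cost_nonneg {U : Type*} {c : X × U → ℝ} (hc0 : ∀ p, 0 ≤ c p) (y : Q.reps) (u : U) :
    0 ≤ Q.cost π c y u :=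
  integral_nonneg fun _ => hc0 _

theorem cost_le {U : Type*} {c : X × U → ℝ} [IsProbabilityMeasure π] (hπ : ∀ y, 0 < π (Q.bin y))
    (hcC : ∀ p, |c p| ≤ C) (y : Q.reps) (u : U) :
    Q.cost π c y u ≤ C := by
  have := Q.isProbabilityMeasure_restrict_bin hπ y
  exact (le_abs_self _).trans (abs_integral_le_of_abs_le fun x => hcC (x, u))

/-- The state-action values of the finite model. -/
noncomputable def actionValue (π : Measure X) (T : Kernel (X × U) X) (c : X × U → ℝ) (β : ℝ)
    (J : Q.reps → ℝ) (y : Q.reps) (u : U) : ℝ :=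
  Q.cost π c y u + β * ∑ z, J z * Q.prob π T z y u

theorem abs_sum_mul_prob_le [IsProbabilityMeasure π] [IsMarkovKernel T] (hπ : ∀ y, 0 < π (Q.bin y))
    {J : Q.reps → ℝ} {M : ℝ}
    (hJ : ∀ z, |J z| ≤ M) (y : Q.reps) (u : U) : |∑ z, J z * Q.prob π T z y u| ≤ M := by
  calc |∑ z, J z * Q.prob π T z y u| ≤ ∑ z, |J z * Q.prob π T z y u| :=
        Finset.abs_sum_le_sum_abs _ _
    _ ≤ ∑ z, M * Q.prob π T z y u := Finset.sum_le_sum fun z _ => by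
        rw [abs_mul, abs_of_nonneg (Q.prob_nonneg T z y u)]
        exact mul_le_mul_of_nonneg_right (hJ z) (Q.prob_nonneg T z y u)
    _ = M := by rw [← Finset.mul_sum, Q.sum_prob T hπ, mul_one]

/-- Needed for the real infimum over actions to be a genuine lower bound rather than the default
value `0`. -/
theorem bddBelow_actionValue [IsProbabilityMeasure π] [IsMarkovKernel T]
    (hπ : ∀ y, 0 < π (Q.bin y)) (hc0 : ∀ p, 0 ≤ c p) (hβ₀ : 0 < β)
    (J : Q.reps → ℝ) (y : Q.reps) : BddBelow (Set.range (Q.actionValue π T c β J y)) := by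
  refine ⟨-(β * ‖J‖), ?_⟩
  rintro _ ⟨u, rfl⟩
  have h1 := Q.cost_nonneg (π := π) hc0 y u
  have h2 := neg_le_of_abs_le (Q.abs_sum_mul_prob_le T hπ (fun z => norm_le_pi_norm J z) y u)
  have h3 := mul_le_mul_of_nonneg_left h2 hβ₀.le
  unfold actionValue
  linarith

/-- The dynamic programming equation of the finite model has a unique solution. -/
theorem existsUnique_isFiniteValue [IsProbabilityMeasure π] [IsMarkovKernel T] [Nonempty U]
    (hπ : ∀ y, 0 < π (Q.bin y))
    (hc0 : ∀ p, 0 ≤ c p) (hβ₀ : 0 < β) (hβ₁ : β < 1) :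
    ∃! J : Q.reps → ℝ, Q.IsFiniteValue π T c β J := by
  set F : (Q.reps → ℝ) → Q.reps → ℝ := fun J y => ⨅ u, Q.actionValue π T c β J y u with hF
  have hcon : ContractingWith ⟨β, hβ₀.le⟩ F := by
    refine ⟨by exact_mod_cast hβ₁, LipschitzWith.of_dist_le_mul fun J K => ?_⟩
    rw [dist_pi_le_iff (by positivity)]
    intro y
    rw [Real.dist_eq]
    change |(⨅ u, Q.actionValue π T c β J y u) - ⨅ u, Q.actionValue π T c β K y u| ≤ β * dist J K
    refine abs_ciInf_sub_ciInf_le (Q.bddBelow_actionValue T hπ hc0 hβ₀ J y)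
      (Q.bddBelow_actionValue T hπ hc0 hβ₀ K y) fun u => ?_
    have : Q.actionValue π T c β J y u - Q.actionValue π T c β K y u =
        β * ∑ z, (J z - K z) * Q.prob π T z y u := by
      simp only [actionValue, sub_mul, Finset.sum_sub_distrib]
      ring
    rw [this, abs_mul, abs_of_pos hβ₀]
    exact mul_le_mul_of_nonneg_left
      (Q.abs_sum_mul_prob_le T hπ (fun z => dist_le_pi_dist J K z) y u) hβ₀.le
  refine ⟨hcon.fixedPoint, fun y => (congrFun hcon.fixedPoint_isFixedPt y).symm, fun J hJ => ?_⟩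
  exact hcon.fixedPoint_unique (funext fun y => (hJ y).symm)

variable {J : Q.reps → ℝ}

theorem IsFiniteValue.le_actionValue [IsProbabilityMeasure π] [IsMarkovKernel T] {Q : Quantizer X}
    {J : Q.reps → ℝ}
    (hJ : Q.IsFiniteValue π T c β J) (hπ : ∀ y, 0 < π (Q.bin y)) (hc0 : ∀ p, 0 ≤ c p)
    (hβ₀ : 0 < β) (y : Q.reps) (u : U) : J y ≤ Q.actionValue π T c β J y u :=
  (hJ y).trans_le (ciInf_le (Q.bddBelow_actionValue T hπ hc0 hβ₀ J y) u)

theorem IsFiniteValue.exists_actionValue_lt [Nonempty U] {Q : Quantizer X} {J : Q.reps → ℝ}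
    (hJ : Q.IsFiniteValue π T c β J) {ε : ℝ} (hε : 0 < ε) (y : Q.reps) :
    ∃ u, Q.actionValue π T c β J y u < J y + ε :=
  exists_lt_of_ciInf_lt (f := Q.actionValue π T c β J y)
    ((hJ y).symm.trans_lt (lt_add_of_pos_right _ hε))

/-- Minimum principle: at a minimizer `m` every action value is at least `β * J m`, so `β * J m ≤ J
m`, which forces `0 ≤ J m`. -/
theorem IsFiniteValue.nonneg [IsProbabilityMeasure π] [IsMarkovKernel T] [Nonempty U]
    {Q : Quantizer X} {J : Q.reps → ℝ}
    (hJ : Q.IsFiniteValue π T c β J) (hπ : ∀ y, 0 < π (Q.bin y)) (hc0 : ∀ p, 0 ≤ c p)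
    (hβ₀ : 0 < β) (hβ₁ : β < 1) (y : Q.reps) : 0 ≤ J y := by
  have : Nonempty Q.reps := ⟨y⟩
  obtain ⟨m, hm⟩ := Finite.exists_min J
  have h1 : β * J m ≤ J m := by
    conv_rhs => rw [hJ m]
    refine le_ciInf fun u => ?_
    have h2 : J m ≤ ∑ z, J z * Q.prob π T z m u := by
      calc J m = ∑ z, J m * Q.prob π T z m u := by rw [← Finset.mul_sum, Q.sum_prob T hπ, mul_one]
        _ ≤ _ := Finset.sum_le_sum fun z _ =>
          mul_le_mul_of_nonneg_right (hm z) (Q.prob_nonneg T z m u)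
    have h3 := mul_le_mul_of_nonneg_left h2 hβ₀.le
    linarith [Q.cost_nonneg (π := π) hc0 m u]
  refine le_trans ?_ (hm y)
  nlinarith

/-- Maximum principle: at a maximizer `m` any single action gives `J m ≤ C + β * J m`. -/
theorem IsFiniteValue.le [IsProbabilityMeasure π] [IsMarkovKernel T] [Nonempty U] {Q : Quantizer X}
    {J : Q.reps → ℝ}
    (hJ : Q.IsFiniteValue π T c β J) (hπ : ∀ y, 0 < π (Q.bin y)) (hc0 : ∀ p, 0 ≤ c p)
    (hcC : ∀ p, |c p| ≤ C) (hβ₀ : 0 < β) (hβ₁ : β < 1) (y : Q.reps) : J y ≤ C / (1 - β) := by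
  have : Nonempty Q.reps := ⟨y⟩
  obtain ⟨m, hm⟩ := Finite.exists_max J
  obtain ⟨u⟩ := ‹Nonempty U›
  have h1 := hJ.le_actionValue T hπ hc0 hβ₀ m u
  have h2 : ∑ z, J z * Q.prob π T z m u ≤ J m := by
    calc ∑ z, J z * Q.prob π T z m u ≤ ∑ z, J m * Q.prob π T z m u :=
          Finset.sum_le_sum fun z _ => mul_le_mul_of_nonneg_right (hm z) (Q.prob_nonneg T z m u)
      _ = J m := by rw [← Finset.mul_sum, Q.sum_prob T hπ, mul_one]
  have h3 := mul_le_mul_of_nonneg_left h2 hβ₀.le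
  have h4 := Q.cost_le (π := π) hπ hcC m u
  rw [actionValue] at h1
  refine (hm y).trans ?_
  rw [le_div_iff₀ (by linarith)]
  linarith

/-- The difference, at the state `x` and the action `u`, between the state-action value of the
finite model and the one that uses the true cost and transition probabilities at `x`. -/
noncomputable def modelError (π : Measure X) (T : Kernel (X × U) X) (c : X × U → ℝ) (β : ℝ)
    (J : Q.reps → ℝ) (p : X × U) : ℝ :=
  Q.actionValue π T c β J (Q.q p.1) p.2 - (c p + β * ∫ y, J (Q.q y) ∂T p)

theorem measurable_actionValue [SFinite π] (hc : Measurable c) (J : Q.reps → ℝ) (y : Q.reps) :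
    Measurable (Q.actionValue π T c β J y) := by
  have h : ∀ g : X × U → ℝ, Measurable g →
      Measurable fun u => ∫ x in Q.bin y, g (x, u) ∂Q.binMeasure π y := fun g hg => by
    have : SFinite (Q.binMeasure π y) := by unfold binMeasure; infer_instance
    exact (StronglyMeasurable.integral_prod_right' (f := fun p : U × X => g (p.2, p.1))
      (hg.comp measurable_swap).stronglyMeasurable).measurable
  exact (h c hc).add ((Finset.measurable_sum _ fun z _ =>
    (h _ (Q.measurable_real_bin T z)).const_mul _).const_mul _)

/-- The quantized state takes finitely many values, so joint measurability reduces to measurability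
in the action for each representative. -/
theorem measurable_modelError [SFinite π] [IsMarkovKernel T] [MeasurableSingletonClass X]
    (hc : Measurable c) (J : Q.reps → ℝ) :
    Measurable (Q.modelError π T c β J) := by
  have h1 : Measurable fun p : Q.reps × U => Q.actionValue π T c β J p.1 p.2 :=
    measurable_from_prod_countable_right fun y => Q.measurable_actionValue T hc J y
  have h2 : Measurable fun p : X × U => Q.actionValue π T c β J (Q.q p.1) p.2 :=
    Measurable.comp (g := fun p : Q.reps × U => Q.actionValue π T c β J p.1 p.2)
      (f := fun p : X × U => (Q.q p.1, p.2)) h1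
      ((Q.measurable_q.comp measurable_fst).prodMk measurable_snd)
  have h3 : Measurable fun p : X × U => ∫ y, J (Q.q y) ∂T p := by
    simp_rw [Q.integral_comp_q]
    exact Finset.measurable_sum _ fun z _ => (Q.measurable_real_bin T z).const_mul _
  have h4 : Measurable fun p : X × U => Q.actionValue π T c β J (Q.q p.1) p.2 -
      (c p + β * ∫ y, J (Q.q y) ∂T p) := h2.sub (hc.add (h3.const_mul β))
  exact h4

/-- A crude uniform bound, which serves integrability; the sharp estimate is the one by the loss. -/
theorem abs_modelError_le [IsProbabilityMeasure π] [IsMarkovKernel T] (hπ : ∀ y, 0 < π (Q.bin y))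
    (hcC : ∀ p, |c p| ≤ C) (hβ₀ : 0 < β)
    (p : X × U) : |Q.modelError π T c β J p| ≤ 2 * (C + β * ‖J‖) := by
  have := Q.isProbabilityMeasure_restrict_bin hπ (Q.q p.1)
  have h1 := abs_le.1 (Q.abs_sum_mul_prob_le T hπ (fun z => norm_le_pi_norm J z) (Q.q p.1) p.2)
  have h2 : |∫ y, J (Q.q y) ∂T p| ≤ ‖J‖ := abs_integral_le_of_abs_le fun y => norm_le_pi_norm J _
  have h3 : |Q.cost π c (Q.q p.1) p.2| ≤ C := abs_integral_le_of_abs_le fun x => hcC (x, p.2)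
  have h4 := hcC p
  rw [abs_le] at h2 h3 h4 ⊢
  have h5 := mul_le_mul_of_nonneg_left h1.1 hβ₀.le
  have h6 := mul_le_mul_of_nonneg_left h1.2 hβ₀.le
  have h7 := mul_le_mul_of_nonneg_left h2.1 hβ₀.le
  have h8 := mul_le_mul_of_nonneg_left h2.2 hβ₀.le
  unfold modelError actionValue
  constructor <;> linarith

/-- The weighting measure on the bin has mass one, so the terms at the fixed state `x` can be moved
under the average. -/
theorem modelError_eq_integral [IsProbabilityMeasure π] [IsMarkovKernel T]
    (hπ : ∀ y, 0 < π (Q.bin y)) (hc : Measurable c)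
    (hcC : ∀ p, |c p| ≤ C) (x : X) (u : U) :
    Q.modelError π T c β J (x, u) = ∫ x' in Q.bin (Q.q x), (c (x', u) - c (x, u) +
      β * ∑ z, J z * ((T (x', u)).real (Q.bin z) - (T (x, u)).real (Q.bin z)))
        ∂Q.binMeasure π (Q.q x) := by
  have := Q.isProbabilityMeasure_restrict_bin hπ (Q.q x)
  have i1 : Integrable (fun x' => c (x', u)) ((Q.binMeasure π (Q.q x)).restrict (Q.bin (Q.q x))) :=
    integrable_of_abs_le (by fun_prop) fun x' => hcC (x', u)
  have i2 := fun z => Q.integrable_real_bin T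
    ((Q.binMeasure π (Q.q x)).restrict (Q.bin (Q.q x))) z u
  have i3 : ∀ z, Integrable (fun x' => J z * ((T (x', u)).real (Q.bin z) -
      (T (x, u)).real (Q.bin z))) ((Q.binMeasure π (Q.q x)).restrict (Q.bin (Q.q x))) :=
    fun z => ((i2 z).sub (integrable_const _)).const_mul _
  have i4 : Integrable (fun x' => c (x', u) - c (x, u))
      ((Q.binMeasure π (Q.q x)).restrict (Q.bin (Q.q x))) := i1.sub (integrable_const _)
  rw [integral_add i4 ((integrable_finsetSum _ fun z _ => i3 z).const_mul β),
    integral_sub i1 (integrable_const _), integral_const_mul,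
    integral_finsetSum _ fun z _ => i3 z]
  have h : ∀ z, ∫ x' in Q.bin (Q.q x), J z * ((T (x', u)).real (Q.bin z) -
      (T (x, u)).real (Q.bin z)) ∂Q.binMeasure π (Q.q x) =
      J z * Q.prob π T z (Q.q x) u - J z * (T (x, u)).real (Q.bin z) := fun z => by
    rw [integral_const_mul, integral_sub (i2 z) (integrable_const _), prob, mul_sub]
    simp
  simp_rw [h, modelError, actionValue, Q.integral_comp_q, Finset.sum_sub_distrib, cost]
  simp
  ring

end Model

/-- The model error is controlled by the quantization loss. -/
theorem ofReal_abs_modelError_le {n : ℕ} {S : Set (L1Space n)} (Q : Quantizer S)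
    {π : Measure S} [IsProbabilityMeasure π] (hπ : ∀ y, 0 < π (Q.bin y))
    (T : Kernel (S × U) S) [IsMarkovKernel T] {c : S × U → ℝ} (hc : Measurable c) {C M β : ℝ}
    (hcC : ∀ p, |c p| ≤ C) (hβ₀ : 0 < β) {αc αT : ℝ} (hαc : 0 < αc) (hαT : 0 < αT)
    (hcLip : ∀ (x x' : S) (u : U),
      |c (x, u) - c (x', u)| ≤ αc * ‖(x : L1Space n) - (x' : L1Space n)‖)
    (hTLip : ∀ (x x' : S) (u : U),
      tvDist (T (x, u)) (T (x', u)) ≤ αT * ‖(x : L1Space n) - (x' : L1Space n)‖)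
    {J : Q.reps → ℝ} (hJ0 : ∀ y, 0 ≤ J y) (hM0 : 0 ≤ M) (hJM : ∀ y, J y ≤ M) (p : S × U) :
    ENNReal.ofReal |Q.modelError π T c β J p| ≤
      ENNReal.ofReal (αc + β * αT * M) * Q.loss π p.1 := by
  obtain ⟨x, u⟩ := p
  rw [Q.modelError_eq_integral T hπ hc hcC, ← Real.enorm_eq_ofReal_abs, loss,
    ← lintegral_const_mul' _ _ ENNReal.ofReal_ne_top]
  -- The estimate is pointwise in `x'`, in `[0, ∞]`, so it survives an infinite loss.
  refine (enorm_integral_le_lintegral_enorm _).trans (lintegral_mono fun x' => ?_)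
  rw [Real.enorm_eq_ofReal_abs, ← ofReal_norm, ← ENNReal.ofReal_mul (by positivity)]
  refine ENNReal.ofReal_le_ofReal ((abs_add_le _ _).trans ?_)
  rw [abs_mul, abs_of_pos hβ₀]
  have h1 := hcLip x x' u
  have h2 := Q.abs_sum_mul_sub_le (T (x', u)) (T (x, u)) hJ0 hM0 hJM
  rw [tvDist_comm] at h2
  have h3 := mul_le_mul_of_nonneg_left
    (h2.trans (mul_le_mul_of_nonneg_left (hTLip x x' u) hM0)) hβ₀.le
  rw [abs_sub_comm] at h1
  calc _ ≤ _ := add_le_add h1 h3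
    _ = _ := by ring

end Quantizer

/-! ### The Bellman equation of the original model. -/

section Bellman

variable {X U : Type*} [TopologicalSpace X] [MeasurableSpace X] [MetricSpace U] [MeasurableSpace U]
  (T : Kernel (X × U) X) (c : (X × U) →ᵇ ℝ) {β : ℝ}

theorem abs_stage_add_le [IsMarkovKernel T] (hβ₀ : 0 < β) (v : X →ᵇ ℝ) (p : X × U) :
    |c p + β * ∫ y, v y ∂T p| ≤ ‖c‖ + β * ‖v‖ := by
  refine (abs_add_le _ _).trans (add_le_add (c.norm_coe_le_norm p) ?_)
  rw [abs_mul, abs_of_pos hβ₀]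
  gcongr
  exact abs_integral_le_of_abs_le v.norm_coe_le_norm

theorem bddBelow_stage_add [IsMarkovKernel T] (hβ₀ : 0 < β) (v : X →ᵇ ℝ) (x : X) :
    BddBelow (Set.range fun u : U => c (x, u) + β * ∫ y, v y ∂T (x, u)) := by
  refine ⟨-(‖c‖ + β * ‖v‖), ?_⟩
  rintro _ ⟨u, rfl⟩
  exact neg_le_of_abs_le (abs_stage_add_le T c hβ₀ v (x, u))

/-- For a weak Feller kernel, the Bellman equation has a bounded continuous solution. -/
theorem exists_bellman_solution [OpensMeasurableSpace X] [CompactSpace U] [Nonempty U]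
    [IsMarkovKernel T]
    (hFeller : ∀ g : X →ᵇ ℝ, Continuous fun p : X × U => ∫ y, g y ∂(T p))
    (hβ₀ : 0 < β) (hβ₁ : β < 1) :
    ∃ v : X →ᵇ ℝ, ∀ x, v x = ⨅ u : U, (c (x, u) + β * ∫ y, v y ∂T (x, u)) := by
  have hcont : ∀ v : X →ᵇ ℝ,
      Continuous fun x => ⨅ u : U, (c (x, u) + β * ∫ y, v y ∂T (x, u)) := fun v => by
    -- Compactness of `U` keeps the infimum over actions continuous in the state, so the operator
    -- maps bounded continuous functions to themselves.
    have := IsCompact.continuous_sInf (isCompact_univ (X := U))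
      (f := fun (x : X) (u : U) => c (x, u) + β * ∫ y, v y ∂T (x, u))
      (c.continuous.add ((hFeller v).const_mul β))
    simp only [Set.image_univ] at this
    exact this
  have hbound : ∀ (v : X →ᵇ ℝ) (x : X),
      ‖⨅ u : U, (c (x, u) + β * ∫ y, v y ∂T (x, u))‖ ≤ ‖c‖ + β * ‖v‖ := fun v x => by
    obtain ⟨u⟩ := ‹Nonempty U›
    refine abs_le.2 ⟨@le_ciInf _ _ _ ⟨u⟩ _ _ fun u => ?_,
      (ciInf_le (bddBelow_stage_add T c hβ₀ v x) u).trans ?_⟩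
    · exact neg_le_of_abs_le (abs_stage_add_le T c hβ₀ v (x, u))
    · exact le_of_abs_le (abs_stage_add_le T c hβ₀ v (x, u))
  set F : (X →ᵇ ℝ) → (X →ᵇ ℝ) := fun v =>
    BoundedContinuousFunction.ofNormedAddCommGroup _ (hcont v) _ (hbound v) with hF
  have hcon : ContractingWith ⟨β, hβ₀.le⟩ F := by
    refine ⟨by exact_mod_cast hβ₁, LipschitzWith.of_dist_le_mul fun v w => ?_⟩
    rw [BoundedContinuousFunction.dist_le (by positivity)]
    intro x
    change |(⨅ u : U, (c (x, u) + β * ∫ y, v y ∂T (x, u))) -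
      ⨅ u : U, (c (x, u) + β * ∫ y, w y ∂T (x, u))| ≤ β * dist v w
    refine abs_ciInf_sub_ciInf_le (bddBelow_stage_add T c hβ₀ v x)
      (bddBelow_stage_add T c hβ₀ w x) fun u => ?_
    rw [add_sub_add_left_eq_sub, ← mul_sub, ← integral_sub (v.integrable _) (w.integrable _),
      abs_mul, abs_of_pos hβ₀]
    gcongr
    exact abs_integral_le_of_abs_le fun y =>
      BoundedContinuousFunction.dist_coe_le_dist (f := v) (g := w) y
  exact ⟨hcon.fixedPoint, fun x => (DFunLike.congr_fun hcon.fixedPoint_isFixedPt x).symm⟩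

/-- A solution of the Bellman equation has measurable approximate selectors. -/
theorem exists_measurable_selector [OpensMeasurableSpace X] [CompactSpace U] [Nonempty U]
    [BorelSpace U]
    (hFeller : ∀ g : X →ᵇ ℝ, Continuous fun p : X × U => ∫ y, g y ∂(T p))
    {v : X →ᵇ ℝ} (hv : ∀ x, v x = ⨅ u : U, (c (x, u) + β * ∫ y, v y ∂T (x, u)))
    {ε : ℝ} (hε : 0 < ε) :
    ∃ f : StationaryPolicy X U, ∀ x,
      c (x, f.1 x) + β * ∫ y, v y ∂T (x, f.1 x) ≤ v x + ε := by
  classical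
  have hG : Continuous fun p : X × U => c p + β * ∫ y, v y ∂T p :=
    c.continuous.add ((hFeller v).const_mul β)
  -- By continuity, strict near-optimality is open in the action, so a member of a countable dense
  -- sequence achieves it. The least such index is measurable in `x`, because each condition is open
  -- in `x`.
  have hex : ∀ x, ∃ k : ℕ, c (x, TopologicalSpace.denseSeq U k) +
      β * ∫ y, v y ∂T (x, TopologicalSpace.denseSeq U k) < v x + ε := fun x => by
    obtain ⟨u, hu⟩ := exists_lt_of_ciInf_lt ((hv x).symm.trans_lt (lt_add_of_pos_right _ hε))
    have ho : IsOpen {u : U | c (x, u) + β * ∫ y, v y ∂T (x, u) < v x + ε} :=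
      isOpen_lt (hG.comp (by fun_prop)) continuous_const
    obtain ⟨w, hw, k, rfl⟩ :=
      (TopologicalSpace.denseRange_denseSeq U).inter_open_nonempty _ ho ⟨u, hu⟩
    exact ⟨k, hw⟩
  have hm : Measurable fun x => Nat.find (hex x) := measurable_find hex fun k =>
    (isOpen_lt (hG.comp (by fun_prop)) (by fun_prop)).measurableSet
  exact ⟨⟨fun x => TopologicalSpace.denseSeq U (Nat.find (hex x)), measurable_from_nat.comp hm⟩,
    fun x => (Nat.find_spec (hex x)).le⟩

end Bellman

end QuantizedMDP

/-! ### The two-sided error bound. -/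

theorem mainTheorem4
    {n : ℕ} (S : Set (L1Space n)) (hS : MeasurableSet S)
    {U : Type*} [MetricSpace U] [CompactSpace U] [Nonempty U] [MeasurableSpace U] [BorelSpace U]
    (T : Kernel (S × U) S) [IsMarkovKernel T]
    (hFeller : ∀ g : S →ᵇ ℝ, Continuous fun p : S × U => ∫ y, g y ∂(T p))
    (c : (S × U) →ᵇ ℝ) (hc : ∀ p, 0 ≤ c p)
    (β : ℝ) (hβ₀ : 0 < β) (hβ₁ : β < 1)
    (αc αT : ℝ) (hαc : 0 < αc) (hαT : 0 < αT)
    (hcLip : ∀ (x x' : S) (u : U),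
      |c (x, u) - c (x', u)| ≤ αc * ‖(x : L1Space n) - (x' : L1Space n)‖)
    (hTLip : ∀ (x x' : S) (u : U),
      tvDist (T (x, u)) (T (x', u)) ≤ αT * ‖(x : L1Space n) - (x' : L1Space n)‖)
    (Q : Quantizer S) (π : Measure S) [IsProbabilityMeasure π] (hπ : ∀ y, 0 < π (Q.bin y)) :
    (∃! J : Q.reps → ℝ, Q.IsFiniteValue π T c β J) ∧
    ∀ Jhat : Q.reps → ℝ, Q.IsFiniteValue π T c β Jhat →
      ∀ x₀ : S,
        ENNReal.ofReal |Jhat (Q.q x₀) - optimalCost T c β x₀| ≤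
          ENNReal.ofReal ((αc + β * αT * ‖c‖ / (1 - β)) * (1 / (1 - β))) *
            ⨆ f : StationaryPolicy S U, ∫⁻ x, Q.loss π x ∂(occupationMeasure T β f x₀) := by
  refine ⟨Q.existsUnique_isFiniteValue T hπ hc hβ₀ hβ₁, fun J hJ x₀ => ?_⟩
  have h1β : 0 < 1 - β := sub_pos.2 hβ₁
  have hcm : Measurable c := c.continuous.measurable
  have hcC : ∀ p, |c p| ≤ ‖c‖ := c.norm_coe_le_norm
  have hM0 : 0 ≤ ‖c‖ / (1 - β) := by positivity
  set D : S × U → ℝ := Q.modelError π T c β J with hD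
  have hDm : Measurable fun p => |D p| := (Q.measurable_modelError T hcm J).abs
  have hDC : ∀ p, |D p| ≤ 2 * (‖c‖ + β * ‖J‖) := Q.abs_modelError_le T hπ hcC hβ₀
  have hDC' : ∀ p, |(|D p|)| ≤ 2 * (‖c‖ + β * ‖J‖) := fun p => by rw [abs_abs]; exact hDC p
  have hDL := Q.ofReal_abs_modelError_le hπ T hcm hcC hβ₀ hαc hαT hcLip hTLip
    (hJ.nonneg T hπ hc hβ₀ hβ₁) hM0 (hJ.le T hπ hc hcC hβ₀ hβ₁)
  have hJm : Measurable fun x => J (Q.q x) := (measurable_of_countable J).comp Q.measurable_q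
  have hJC : ∀ x, |J (Q.q x)| ≤ ‖J‖ := fun x => norm_le_pi_norm J _
  set R : ℝ≥0∞ := ENNReal.ofReal ((αc + β * αT * ‖c‖ / (1 - β)) * (1 / (1 - β))) *
    ⨆ f : StationaryPolicy S U, ∫⁻ x, Q.loss π x ∂(occupationMeasure T β f x₀) with hR
  have hRD : ∀ f : StationaryPolicy S U,
      ENNReal.ofReal (discountedCost T (fun p => |D p|) β f.toAdmissible x₀) ≤ R := fun f => by
    refine (ofReal_discountedCost_le T x₀ hβ₀ hβ₁ f hDm (fun p => abs_nonneg _) hDC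
      ENNReal.ofReal_ne_top hDL).trans ?_
    rw [hR, ← ENNReal.ofReal_mul (by positivity), mul_div_assoc]
    gcongr
    exact le_iSup (fun f : StationaryPolicy S U =>
      ∫⁻ x, Q.loss π x ∂(occupationMeasure T β f x₀)) f
  rcases eq_or_ne R ∞ with hRtop | hRtop
  · rw [hRtop]; exact le_top
  have hRD' : ∀ f : StationaryPolicy S U,
      discountedCost T (fun p => |D p|) β f.toAdmissible x₀ ≤ R.toReal := fun f =>
    (ENNReal.ofReal_le_iff_le_toReal hRtop).1 (hRD f)
  have hcost0 : ∀ γ : AdmissiblePolicy S U, 0 ≤ discountedCost T c β γ x₀ := fun γ =>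
    integral_nonneg fun ω => tsum_nonneg fun t => mul_nonneg (by positivity) (hc _)
  have hbdd : BddBelow (Set.range fun γ : AdmissiblePolicy S U => discountedCost T c β γ x₀) :=
    ⟨0, by rintro _ ⟨γ, rfl⟩; exact hcost0 γ⟩
  obtain ⟨v, hv⟩ := exists_bellman_solution T c hFeller hβ₀ hβ₁
  have hvm : Measurable v := v.continuous.measurable
  obtain ⟨u₀⟩ := ‹Nonempty U›
  have : Nonempty (AdmissiblePolicy S U) :=
    ⟨StationaryPolicy.toAdmissible ⟨fun _ => u₀, measurable_const⟩⟩
  have : Nonempty U := ⟨u₀⟩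
  -- Only this half of `v = J*` is needed; it is the comparison principle with `ε = 0`.
  have hvopt : v x₀ ≤ optimalCost T c β x₀ := le_ciInf fun γ => by
    have := sub_le_discountedCost T γ x₀ hβ₀ hβ₁ hvm v.norm_coe_le_norm hcm hcC (ε := 0)
      fun t => Filter.Eventually.of_forall fun ω => by
        rw [add_zero, hv]
        exact ciInf_le (bddBelow_stage_add T c hβ₀ v (ω t).1) (ω t).2
    simpa using this
  have hupper : ∀ ε > 0, J (Q.q x₀) - optimalCost T c β x₀ ≤ R.toReal + ε / (1 - β) := by
    intro ε hε
    obtain ⟨f, hf⟩ := exists_measurable_selector T c hFeller hv hε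
    have := sub_le_discountedCost T f.toAdmissible x₀ hβ₀ hβ₁ (v := fun x => J (Q.q x) - v x)
      (hJm.sub hvm) (C := ‖J‖ + ‖v‖)
      (fun x => (abs_sub _ _).trans (add_le_add (hJC x) (v.norm_coe_le_norm x))) hDm hDC' (ε := ε)
      fun t => by
        filter_upwards [ae_action_eq T x₀ f t] with ω hω
        rw [integral_sub (integrable_of_abs_le hJm hJC) (v.integrable _)]
        have h1 := hJ.le_actionValue T hπ hc hβ₀ (Q.q (ω t).1) (ω t).2
        have h2 := hf (ω t).1
        rw [← hω] at h2
        have h3 := le_abs_self (D (ω t))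
        simp only [hD, Quantizer.modelError] at h3 ⊢
        -- `J(q x) ≤ c + β ∫ J ∘ q + D`, while `v ≥ c + β ∫ v - ε` for the selected action;
        -- subtracting cancels `c`.
        linarith
    linarith [hRD' f]
  have hlower : ∀ ε > 0, optimalCost T c β x₀ - J (Q.q x₀) ≤ R.toReal + ε / (1 - β) := by
    intro ε hε
    choose g hg using hJ.exists_actionValue_lt T hε
    set f : StationaryPolicy S U := ⟨fun x => g (Q.q x),
      (measurable_of_countable g).comp Q.measurable_q⟩ with hf
    have := sub_le_discountedCost T f.toAdmissible x₀ hβ₀ hβ₁ (v := fun x => -J (Q.q x))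
      hJm.neg (C := ‖J‖) (fun x => by rw [abs_neg]; exact hJC x) (hDm.sub hcm)
      (fun p => (abs_sub _ _).trans (add_le_add (hDC' p) (hcC p))) (ε := ε)
      fun t => by
        filter_upwards [ae_action_eq T x₀ f t] with ω hω
        rw [integral_neg]
        have h1 := hg (Q.q (ω t).1)
        change (ω t).2 = g (Q.q (ω t).1) at hω
        rw [← hω] at h1
        have h3 := neg_abs_le (D (ω t))
        simp only [hD, Quantizer.modelError, Pi.sub_apply] at h3 ⊢
        -- Near-optimality of `g` reads `c + β ∫ J ∘ q + D < J(q x) + ε`; now change signs and bound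
        -- `-D` by `|D|`.
        linarith
    have h4 := discountedCost_sub T f.toAdmissible x₀ hβ₀ hβ₁ hDm hDC' hcm hcC
    have h5 : optimalCost T c β x₀ ≤ _ := ciInf_le hbdd f.toAdmissible
    change _ ≤ discountedCost T (fun p => |D p| - c p) β _ _ at this
    linarith [hRD' f]
  -- Taking `ε = δ * (1 - β)` turns the error term into an arbitrary `δ > 0`.
  have hlim : ∀ a : ℝ, (∀ ε > 0, a ≤ R.toReal + ε / (1 - β)) → a ≤ R.toReal := fun a ha =>
    le_of_forall_pos_le_add fun δ hδ => by
      simpa [h1β.ne'] using ha (δ * (1 - β)) (by positivity)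
  rw [ENNReal.ofReal_le_iff_le_toReal hRtop, abs_le']
  exact ⟨hlim _ hupper, by rw [neg_sub]; exact hlim _ hlower⟩
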